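/- Identify the Riemann sphere $\widehat{\mathbb{C}}=\mathbb{C}\cup\{\infty\}$ with $\mathbb{CP}^1$ by $z\mapsto[z:1]$ for $z\in\mathbb{C}$ and $\infty\mapsto[1:0]$, and let $$d_{FS}(z,w)=\frac{2}{\pi}\arccos\frac{|\langle z,w\rangle|}{\|z\|\,\|w\|}$$ be the normalized Fubini--Study distance, where on the right $z,w$ stand for homogeneous coordinate vectors in $\mathbb{C}^2\setminus\{0\}$ with the standard Hermitian inner product. Let $R:\widehat{\mathbb{C}}\to\widehat{\mathbb{C}}$ be a complex rational map of degree $d\ge 2$ (that is, $R=P/Q$ with coprime polynomials $P,Q$ and $d=\max(\deg P,\deg Q)$), and let $R^n$ denote its $n$-th iterate, with $R^0=\mathrm{id}$. Then there exists an integer $N\ge 0$, depending only on $R$, such that for all $z_0,w_0\in\widehat{\mathbb{C}}$, with $z_n=R^n(z_0)$ and $w_n=R^n(w_0)$: if $d_{FS}(0,z_n)=d_{FS}(0,w_n)$ for all $0\le n\le N$, then $d_{FS}(0,z_n)=d_{FS}(0,w_n)$ for every $n\ge 0$. -/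

import Mathlib

open scoped LinearAlgebra.Projectivization

noncomputable section

/-- The Riemann sphere `ℂ ∪ {∞}`. -/
abbrev RiemannSphere : Type := OnePoint ℂ

/-- The complex projective line, with homogeneous coordinates in the Hermitian space `ℂ²`. -/
abbrev CP1 : Type := ℙ ℂ (EuclideanSpace ℂ (Fin 2))

namespace CP1

/-- The normalized Fubini-Study distance on the projective line,
`(2 / π) * arccos (|⟨z, w⟩| / (‖z‖ * ‖w‖))` for any choice of homogeneous coordinates. -/
def fsDist (p q : CP1) : ℝ :=
  Projectivization.lift
    (fun z : {v : EuclideanSpace ℂ (Fin 2) // v ≠ 0} =>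
      Projectivization.lift
        (fun w : {v : EuclideanSpace ℂ (Fin 2) // v ≠ 0} =>
          2 / Real.pi * Real.arccos (‖inner ℂ z.1 w.1‖ / (‖z.1‖ * ‖w.1‖)))
        (by
          rintro ⟨a, ha⟩ ⟨b, hb⟩ t rfl
          have ht : ‖t‖ ≠ 0 := by
            rw [norm_ne_zero_iff]
            rintro rfl
            simp at ha
          simp only [inner_smul_right, norm_mul, norm_smul]
          rw [mul_left_comm ‖z.1‖, mul_div_mul_left _ _ ht]) q)
    (by
      rintro ⟨a, ha⟩ ⟨b, hb⟩ t rfl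
      have ht : ‖t‖ ≠ 0 := by
        rw [norm_ne_zero_iff]
        rintro rfl
        simp at ha
      induction q using Projectivization.ind with
      | h w hw =>
        simp only [Projectivization.lift_mk, inner_smul_left, norm_mul, norm_smul,
          RCLike.norm_conj]
        rw [mul_assoc ‖t‖, mul_div_mul_left _ _ ht]) p

end CP1

namespace RiemannSphere

/-- The identification of the Riemann sphere with the projective line: `z ↦ [z : 1]`, `∞ ↦ [1 : 0]`.
In particular `0 ↦ [0 : 1]`. -/
def toCP1 (z : RiemannSphere) : CP1 :=
  OnePoint.elim z
    (Projectivization.mk ℂ !₂[(1 : ℂ), 0]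
      (fun h => one_ne_zero (congrArg (fun v : EuclideanSpace ℂ (Fin 2) => v 0) h)))
    (fun t : ℂ => Projectivization.mk ℂ !₂[t, (1 : ℂ)]
      (fun h => one_ne_zero (congrArg (fun v : EuclideanSpace ℂ (Fin 2) => v 1) h)))

/-- The normalized Fubini-Study distance on the Riemann sphere. -/
def fsDist (z w : RiemannSphere) : ℝ :=
  CP1.fsDist z.toCP1 w.toCP1

end RiemannSphere

namespace RatFunc

/-- The degree of a rational function as a self-map of the sphere: the maximum of the degrees of
numerator and denominator in lowest terms. -/
def mapDegree (R : RatFunc ℂ) : ℕ :=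
  max R.num.natDegree R.denom.natDegree

open Classical in
/-- The self-map of the Riemann sphere defined by a rational function `P / Q` in lowest terms.
Poles go to `∞`, and the value at `∞` is the quotient of the coefficients of `P` and `Q` in degree
`d = max (deg P) (deg Q)`, read as `∞` if `Q` has degree less than `d`. -/
def sphereMap (R : RatFunc ℂ) (x : RiemannSphere) : RiemannSphere :=
  OnePoint.elim x
    (if R.denom.coeff R.mapDegree = 0 then OnePoint.infty
      else ((R.num.coeff R.mapDegree / R.denom.coeff R.mapDegree : ℂ) : RiemannSphere))
    (fun z : ℂ =>
      if R.denom.eval z = 0 then OnePoint.infty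
      else ((R.num.eval z / R.denom.eval z : ℂ) : RiemannSphere))

end RatFunc

end

/-! Two points `[x : y]` and `[x' : y']` are equidistant from `0` exactly when `|x|²|y'|² =
|x'|²|y|²`, a polynomial equation in the four coordinates and their conjugates. Lifting the map to
homogeneous polynomials on `ℂ²` and iterating turns the condition at time `n` into the vanishing at
`(x, y, x', y')` of one such function `f n`. All `f n` lie in the algebra of functions on `ℂ⁴`
generated by coordinates and conjugates, which is Noetherian by Hilbert's basis theorem. The ideals
generated by `f 0, …, f n` therefore stabilize at some `N`, chosen before any point is. -/

open Polynomial in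
/-- The value at `(x, y)` of the degree `d` homogenization of a polynomial `p`. -/
def Polynomial.homEval {A : Type*} [CommRing A] [Algebra ℂ A] (p : ℂ[X]) (d : ℕ) (x y : A) : A :=
  ∑ i ∈ Finset.range (d + 1), algebraMap ℂ A (p.coeff i) * x ^ i * y ^ (d - i)

open Polynomial in
theorem Polynomial.homEval_zero_right (p : ℂ[X]) (d : ℕ) (x : ℂ) :
    p.homEval d x 0 = p.coeff d * x ^ d := by
  rw [homEval, Finset.sum_eq_single d]
  · simp
  · intro i hi hid
    have hlt : d - i ≠ 0 := by
      have := Finset.mem_range.mp hi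
      omega
    simp [hlt]
  · simp

open Polynomial in
theorem Polynomial.homEval_eq_eval_div (p : ℂ[X]) {d : ℕ} (hd : p.natDegree ≤ d) (x : ℂ) {y : ℂ}
    (hy : y ≠ 0) : p.homEval d x y = y ^ d * p.eval (x / y) := by
  rw [homEval, eval_eq_sum_range' (Nat.lt_succ_of_le hd), Finset.mul_sum]
  refine Finset.sum_congr rfl fun i hi => ?_
  have hle : i ≤ d := Nat.lt_succ_iff.mp (Finset.mem_range.mp hi)
  rw [div_pow, ← Nat.sub_add_cancel hle, pow_add, Nat.add_sub_cancel]
  simp only [Algebra.algebraMap_self, RingHom.id_apply]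
  field_simp

namespace RiemannSphere

open Classical in
/-- The point of the sphere with homogeneous coordinates `[x : y]`. -/
noncomputable def ofHom (x y : ℂ) : RiemannSphere :=
  if y = 0 then OnePoint.infty else ((x / y : ℂ) : RiemannSphere)

theorem exists_ofHom (z : RiemannSphere) :
    ∃ x y : ℂ, (x ≠ 0 ∨ y ≠ 0) ∧ z = ofHom x y := by
  induction z using OnePoint.rec with
  | infty => exact ⟨1, 0, by simp, by simp [ofHom]⟩
  | coe t => exact ⟨t, 1, by simp, by simp [ofHom]⟩

theorem fsDist_zero_ofHom {x y : ℂ} (h : x ≠ 0 ∨ y ≠ 0) :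
    fsDist ((0 : ℂ) : RiemannSphere) (ofHom x y) =
      2 / Real.pi * Real.arccos (‖y‖ / √(‖x‖ ^ 2 + ‖y‖ ^ 2)) := by
  by_cases hy : y = 0
  · subst hy
    simp [ofHom, fsDist, toCP1, CP1.fsDist, EuclideanSpace.norm_eq, PiLp.inner_apply]
  · have hy' : 0 < ‖y‖ := norm_pos_iff.mpr hy
    have key : ‖y‖ / √(‖x‖ ^ 2 + ‖y‖ ^ 2) = 1 / √((‖x‖ / ‖y‖) ^ 2 + 1) := by
      have : ‖x‖ ^ 2 + ‖y‖ ^ 2 = ‖y‖ ^ 2 * ((‖x‖ / ‖y‖) ^ 2 + 1) := by field_simp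
      rw [this, Real.sqrt_mul (by positivity), Real.sqrt_sq hy'.le]
      field_simp
    rw [key]
    simp [ofHom, hy, fsDist, toCP1, CP1.fsDist, EuclideanSpace.norm_eq, PiLp.inner_apply]

/-- Since `arccos` is injective on `[-1, 1]`, its arguments can be compared after squaring; clearing
denominators, the common term `|y|²|y'|²` cancels. -/
theorem fsDist_zero_ofHom_eq_iff {x y x' y' : ℂ} (h : x ≠ 0 ∨ y ≠ 0) (h' : x' ≠ 0 ∨ y' ≠ 0) :
    fsDist ((0 : ℂ) : RiemannSphere) (ofHom x y) = fsDist ((0 : ℂ) : RiemannSphere) (ofHom x' y') ↔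
      ‖x‖ ^ 2 * ‖y'‖ ^ 2 = ‖x'‖ ^ 2 * ‖y‖ ^ 2 := by
  have pos : ∀ {a b : ℂ}, (a ≠ 0 ∨ b ≠ 0) → 0 < ‖a‖ ^ 2 + ‖b‖ ^ 2 := by
    rintro a b (h | h)
    · have := norm_pos_iff.mpr h
      positivity
    · have := norm_pos_iff.mpr h
      positivity
  have le_one : ∀ a b : ℂ, ‖b‖ / √(‖a‖ ^ 2 + ‖b‖ ^ 2) ≤ 1 := fun a b =>
    div_le_one_of_le₀ (Real.le_sqrt_of_sq_le (by nlinarith [sq_nonneg ‖a‖])) (Real.sqrt_nonneg _)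
  have nonneg : ∀ a b : ℂ, 0 ≤ ‖b‖ / √(‖a‖ ^ 2 + ‖b‖ ^ 2) := fun a b => by positivity
  have hpi : (2 / Real.pi : ℝ) ≠ 0 := by positivity
  rw [fsDist_zero_ofHom h, fsDist_zero_ofHom h', mul_right_inj' hpi,
    Real.arccos_injOn.eq_iff ⟨by linarith [nonneg x y], le_one x y⟩
      ⟨by linarith [nonneg x' y'], le_one x' y'⟩,
    ← sq_eq_sq₀ (nonneg x y) (nonneg x' y'), div_pow, div_pow, Real.sq_sqrt (pos h).le,
    Real.sq_sqrt (pos h').le, div_eq_div_iff (pos h).ne' (pos h').ne']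
  constructor <;> intro e <;> linarith

end RiemannSphere

namespace RatFunc

/-- The homogeneous lift to `A²` of the self-map of the sphere defined by a rational function. -/
noncomputable def homLift {A : Type*} [CommRing A] [Algebra ℂ A] (R : RatFunc ℂ) (v : A × A) : A × A :=
  (R.num.homEval R.mapDegree v.1 v.2, R.denom.homEval R.mapDegree v.1 v.2)

theorem natDegree_num_le_mapDegree (R : RatFunc ℂ) : R.num.natDegree ≤ R.mapDegree :=
  le_max_left _ _

theorem natDegree_denom_le_mapDegree (R : RatFunc ℂ) : R.denom.natDegree ≤ R.mapDegree :=
  le_max_right _ _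

theorem coeff_mapDegree_ne_zero (R : RatFunc ℂ) :
    R.num.coeff R.mapDegree ≠ 0 ∨ R.denom.coeff R.mapDegree ≠ 0 := by
  rcases le_or_gt R.num.natDegree R.denom.natDegree with h | h
  · right
    rw [mapDegree, max_eq_right h]
    exact Polynomial.leadingCoeff_ne_zero.mpr R.denom_ne_zero
  · left
    rw [mapDegree, max_eq_left h.le]
    -- A zero numerator has `natDegree` 0, which cannot strictly exceed that of the denominator.
    refine Polynomial.leadingCoeff_ne_zero.mpr fun h0 => ?_
    simp [h0] at h

/-- A common zero with `y ≠ 0` would give a common root `x / y` of coprime polynomials; at `y = 0`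
only the degree `d` coefficients survive, and they are not both zero. -/
theorem homLift_ne_zero (R : RatFunc ℂ) {v : ℂ × ℂ} (hv : v.1 ≠ 0 ∨ v.2 ≠ 0) :
    (R.homLift v).1 ≠ 0 ∨ (R.homLift v).2 ≠ 0 := by
  obtain ⟨x, y⟩ := v
  by_cases hy : y = 0
  · subst hy
    have hx : x ≠ 0 := by simpa using hv
    simpa [homLift, Polynomial.homEval_zero_right, hx] using R.coeff_mapDegree_ne_zero
  · simp only [homLift]
    rw [Polynomial.homEval_eq_eval_div _ R.natDegree_num_le_mapDegree x hy,
      Polynomial.homEval_eq_eval_div _ R.natDegree_denom_le_mapDegree x hy]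
    by_contra! h
    have hyd := pow_ne_zero R.mapDegree hy
    have h1 := (mul_eq_zero.mp h.1).resolve_left hyd
    have h2 := (mul_eq_zero.mp h.2).resolve_left hyd
    obtain ⟨a, b, hab⟩ := R.isCoprime_num_denom
    have := congrArg (Polynomial.eval (x / y)) hab
    simp [h1, h2] at this

theorem sphereMap_ofHom (R : RatFunc ℂ) {v : ℂ × ℂ} (hv : v.1 ≠ 0 ∨ v.2 ≠ 0) :
    R.sphereMap (RiemannSphere.ofHom v.1 v.2) =
      RiemannSphere.ofHom (R.homLift v).1 (R.homLift v).2 := by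
  obtain ⟨x, y⟩ := v
  by_cases hy : y = 0
  · subst hy
    have hx : x ≠ 0 := by simpa using hv
    have hxd := pow_ne_zero R.mapDegree hx
    simp [homLift, Polynomial.homEval_zero_right, RiemannSphere.ofHom, sphereMap, hx,
      mul_div_mul_right _ _ hxd]
  · have hyd := pow_ne_zero R.mapDegree hy
    simp only [homLift]
    rw [Polynomial.homEval_eq_eval_div _ R.natDegree_num_le_mapDegree x hy,
      Polynomial.homEval_eq_eval_div _ R.natDegree_denom_le_mapDegree x hy]
    simp [RiemannSphere.ofHom, sphereMap, hy, mul_div_mul_left _ _ hyd]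

theorem sphereMap_iterate_ofHom (R : RatFunc ℂ) (n : ℕ) {v : ℂ × ℂ} (hv : v.1 ≠ 0 ∨ v.2 ≠ 0) :
    ((R.homLift^[n] v).1 ≠ 0 ∨ (R.homLift^[n] v).2 ≠ 0) ∧
      R.sphereMap^[n] (RiemannSphere.ofHom v.1 v.2) =
        RiemannSphere.ofHom (R.homLift^[n] v).1 (R.homLift^[n] v).2 := by
  induction n with
  | zero => exact ⟨hv, rfl⟩
  | succ n ih =>
    rw [Function.iterate_succ_apply', Function.iterate_succ_apply', ih.2]
    exact ⟨R.homLift_ne_zero ih.1, R.sphereMap_ofHom ih.1⟩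

/-- Evaluation at a point is an algebra homomorphism, so it commutes with the lift; this ties orbits
of functions to orbits of points. -/
theorem homLift_iterate_apply {X : Type*} (R : RatFunc ℂ) (n : ℕ) (f : (X → ℂ) × (X → ℂ)) (s : X) :
    ((R.homLift^[n] f).1 s, (R.homLift^[n] f).2 s) = R.homLift^[n] (f.1 s, f.2 s) := by
  induction n with
  | zero => rfl
  | succ n ih =>
    rw [Function.iterate_succ_apply', Function.iterate_succ_apply', ← ih]
    simp [homLift, Polynomial.homEval, Finset.sum_apply]

theorem homLift_iterate_mem {A : Type*} [CommRing A] [StarRing A] [Algebra ℂ A] [StarModule ℂ A]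
    (R : RatFunc ℂ) (S : StarSubalgebra ℂ A) (n : ℕ) {v : A × A} (h₁ : v.1 ∈ S) (h₂ : v.2 ∈ S) :
    (R.homLift^[n] v).1 ∈ S ∧ (R.homLift^[n] v).2 ∈ S := by
  induction n with
  | zero => exact ⟨h₁, h₂⟩
  | succ n ih =>
    rw [Function.iterate_succ_apply']
    have mem : ∀ p : Polynomial ℂ,
        p.homEval R.mapDegree (R.homLift^[n] v).1 (R.homLift^[n] v).2 ∈ S := fun p =>
      sum_mem fun i _ => mul_mem (mul_mem (S.algebraMap_mem _) (pow_mem ih.1 _)) (pow_mem ih.2 _)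
    exact ⟨mem _, mem _⟩

end RatFunc

/-- In a sequence of elements of a Noetherian ring, the common zeros of a suitable initial segment
are common zeros of the whole sequence, for all evaluations simultaneously. -/
theorem IsNoetherianRing.exists_forall_map_eq_zero {A B : Type*} [CommRing A] [IsNoetherianRing A]
    [CommRing B] (f : ℕ → A) :
    ∃ N : ℕ, ∀ φ : A →+* B, (∀ n ≤ N, φ (f n) = 0) → ∀ n, φ (f n) = 0 := by
  let I : ℕ →o Ideal A :=
    ⟨fun n => Ideal.span (f '' Set.Iic n), fun _ _ h =>
      Ideal.span_mono (Set.image_mono (Set.Iic_subset_Iic.mpr h))⟩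
  obtain ⟨N, hN⟩ := monotone_stabilizes_iff_noetherian.mpr inferInstance I
  refine ⟨N, fun φ hφ n => ?_⟩
  have hle : I N ≤ RingHom.ker φ := by
    refine Ideal.span_le.mpr ?_
    rintro _ ⟨m, hm, rfl⟩
    exact hφ m hm
  -- The index `max N n` is past stabilization, so this ideal equals `I N`.
  have hmem : f n ∈ I (max N n) := Ideal.subset_span ⟨n, le_max_right N n, rfl⟩
  rw [← hN _ (le_max_left N n)] at hmem
  exact hle hmem

/-- As an ordinary algebra it is generated by the finite set `s ∪ star s`, so Hilbert's basis
theorem applies. -/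
theorem StarAlgebra.isNoetherianRing_adjoin {A : Type*} [CommRing A] [StarRing A] [Algebra ℂ A]
    [StarModule ℂ A] {s : Set A} (hs : s.Finite) :
    IsNoetherianRing (StarAlgebra.adjoin ℂ s) := by
  have hfin : (s ∪ star s).Finite := hs.union (hs.star)
  have : Algebra.FiniteType ℂ (Algebra.adjoin ℂ (s ∪ star s)) :=
    (Subalgebra.fg_iff_finiteType _).mp (Subalgebra.fg_def.mpr ⟨_, hfin, rfl⟩)
  exact Algebra.FiniteType.isNoetherianRing ℂ (Algebra.adjoin ℂ (s ∪ star s))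

theorem lemma1p1 (R : RatFunc ℂ) (hR : 2 ≤ R.mapDegree) :
    ∃ N : ℕ, ∀ z w : RiemannSphere,
      (∀ n ≤ N,
        RiemannSphere.fsDist ((0 : ℂ) : RiemannSphere) (R.sphereMap^[n] z) =
          RiemannSphere.fsDist ((0 : ℂ) : RiemannSphere) (R.sphereMap^[n] w)) →
      ∀ n : ℕ,
        RiemannSphere.fsDist ((0 : ℂ) : RiemannSphere) (R.sphereMap^[n] z) =
          RiemannSphere.fsDist ((0 : ℂ) : RiemannSphere) (R.sphereMap^[n] w) := by
  let e : Fin 4 → (Fin 4 → ℂ) → ℂ := fun i s => s i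
  let S := StarAlgebra.adjoin ℂ (Set.range e)
  have he : ∀ i, e i ∈ S := fun i => StarAlgebra.subset_adjoin ℂ _ ⟨i, rfl⟩
  have : IsNoetherianRing S := StarAlgebra.isNoetherianRing_adjoin (Set.finite_range e)
  let F : ℕ → ((Fin 4 → ℂ) → ℂ) × ((Fin 4 → ℂ) → ℂ) := fun n => R.homLift^[n] (e 0, e 1)
  let G : ℕ → ((Fin 4 → ℂ) → ℂ) × ((Fin 4 → ℂ) → ℂ) := fun n => R.homLift^[n] (e 2, e 3)
  -- Writing `|g|²` as `g * star g` keeps `f n` inside the star subalgebra `S`.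
  let f : ℕ → (Fin 4 → ℂ) → ℂ := fun n =>
    (F n).1 * star (F n).1 * ((G n).2 * star (G n).2) -
      (G n).1 * star (G n).1 * ((F n).2 * star (F n).2)
  have hf : ∀ n, f n ∈ S := fun n => by
    obtain ⟨hF₁, hF₂⟩ := R.homLift_iterate_mem S n (v := (e 0, e 1)) (he 0) (he 1)
    obtain ⟨hG₁, hG₂⟩ := R.homLift_iterate_mem S n (v := (e 2, e 3)) (he 2) (he 3)
    have norm_mem : ∀ {g}, g ∈ S → g * star g ∈ S := fun hg => mul_mem hg (star_mem hg)
    exact sub_mem (mul_mem (norm_mem hF₁) (norm_mem hG₂)) (mul_mem (norm_mem hG₁) (norm_mem hF₂))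
  obtain ⟨N, hN⟩ := IsNoetherianRing.exists_forall_map_eq_zero (B := ℂ) fun n => (⟨f n, hf n⟩ : S)
  refine ⟨N, fun z w => ?_⟩
  obtain ⟨x, y, hxy, rfl⟩ := RiemannSphere.exists_ofHom z
  obtain ⟨x', y', hxy', rfl⟩ := RiemannSphere.exists_ofHom w
  let s : Fin 4 → ℂ := ![x, y, x', y']
  have key : ∀ n,
      RiemannSphere.fsDist ((0 : ℂ) : RiemannSphere)
          (R.sphereMap^[n] (RiemannSphere.ofHom x y)) =
        RiemannSphere.fsDist ((0 : ℂ) : RiemannSphere)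
          (R.sphereMap^[n] (RiemannSphere.ofHom x' y')) ↔ f n s = 0 := fun n => by
    obtain ⟨h, hz⟩ := R.sphereMap_iterate_ofHom n (v := (x, y)) hxy
    obtain ⟨h', hw⟩ := R.sphereMap_iterate_ofHom n (v := (x', y')) hxy'
    rw [hz, hw, RiemannSphere.fsDist_zero_ofHom_eq_iff h h']
    have hF : ((F n).1 s, (F n).2 s) = R.homLift^[n] (x, y) := R.homLift_iterate_apply n _ s
    have hG : ((G n).1 s, (G n).2 s) = R.homLift^[n] (x', y') := R.homLift_iterate_apply n _ s
    rw [← hF, ← hG]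
    simp only [f, Pi.sub_apply, Pi.mul_apply, Pi.star_apply, Complex.star_def, Complex.mul_conj',
      sub_eq_zero]
    norm_cast
  let φ : S →+* ℂ := (Pi.evalRingHom (fun _ : Fin 4 → ℂ => ℂ) s).comp S.toSubalgebra.val.toRingHom
  intro h n
  exact (key n).mpr (hN φ (fun m hm => (key m).mp (h m hm)) n)
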